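/- Let $\mathbb{F}$ be a field of characteristic zero and let $\mathfrak{L}$ be a finite-dimensional left Leibniz algebra over $\mathbb{F}$, i.e., a finite-dimensional $\mathbb{F}$-vector space with a bilinear multiplication satisfying $x(yz)=(xy)z+y(xz)$ for all $x,y,z\in\mathfrak{L}$. Let $\mathrm{Leib}(\mathfrak{L}):=\langle x^2\mid x\in\mathfrak{L}\rangle_{\mathbb{F}}$ be the Leibniz kernel and $C^r(\mathfrak{L}):=\{c\in\mathfrak{L}\mid xc=0\text{ for all }x\in\mathfrak{L}\}$ the right center of $\mathfrak{L}$. Suppose that $\mathfrak{L}$ is semi-simple, i.e., $\mathrm{Leib}(\mathfrak{L})$ contains every solvable two-sided ideal of $\mathfrak{L}$ (an ideal $I$ is solvable if $I^{(n)}=0$ for some $n\ge 0$, where $I^{(0)}:=I$ and $I^{(n+1)}:=\langle ab\mid a,b\in I^{(n)}\rangle_{\mathbb{F}}$), and that $\mathfrak{L}$ is left central, i.e., $\mathrm{Leib}(\mathfrak{L})\subseteq C^r(\mathfrak{L})$. Then $\mathfrak{L}$ is a Lie algebra, i.e., $x^2=0$ and $x(yz)+y(zx)+z(xy)=0$ for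 all $x,y,z\in\mathfrak{L}$. -/

import Mathlib

/-! An algebra over a field `F` is a `NonUnitalNonAssocRing` that is an `F`-vector space with
`F`-bilinear multiplication (`IsScalarTower F L L` and `SMulCommClass F L L`). -/

namespace LeibnizAlg

/-- A left Leibniz algebra: every left multiplication operator `y ↦ x * y` is a derivation. -/
def IsLeftLeibniz (L : Type*) [NonUnitalNonAssocRing L] : Prop :=
  ∀ x y z : L, x * (y * z) = (x * y) * z + y * (x * z)

/-- A Lie algebra: the product is alternating and satisfies the Jacobi identity. -/
structure IsLie (L : Type*) [NonUnitalNonAssocRing L] : Prop where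
  mul_self : ∀ x : L, x * x = 0
  jacobi : ∀ x y z : L, x * (y * z) + y * (z * x) + z * (x * y) = 0

section

variable (F : Type*) {L : Type*} [Field F] [NonUnitalNonAssocRing L] [Module F L]

variable (L) in
/-- The Leibniz kernel: the subspace spanned by all squares. -/
def leibnizKernel : Submodule F L :=
  Submodule.span F {z | ∃ x : L, z = x * x}

variable (L) in
/-- The right center: all `c` with `x * c = 0` for every `x`. -/
def rightCenter [SMulCommClass F L L] : Submodule F L where
  carrier := {c | ∀ x : L, x * c = 0}
  add_mem' := fun ha hb x => by rw [mul_add, ha x, hb x, add_zero]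
  zero_mem' := fun x => mul_zero x
  smul_mem' := fun r c hc x => by rw [mul_smul_comm, hc x, smul_zero]

variable (L) in
/-- Left central: the Leibniz kernel is contained in the right center. -/
def IsLeftCentral [SMulCommClass F L L] : Prop :=
  leibnizKernel F L ≤ rightCenter F L

variable {F}

/-- A subspace that is a two-sided ideal. -/
def IsIdeal (I : Submodule F L) : Prop :=
  ∀ x : L, ∀ a ∈ I, x * a ∈ I ∧ a * x ∈ I

/-- The derived series of a subspace: `I⁽⁰⁾ = I`, and `I⁽ⁿ⁺¹⁾` is the subspace spanned by the
products of two elements of `I⁽ⁿ⁾`. -/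
def derivedSeries (I : Submodule F L) : ℕ → Submodule F L
  | 0 => I
  | n + 1 => Submodule.span F
      {z | ∃ a ∈ derivedSeries I n, ∃ b ∈ derivedSeries I n, z = a * b}

/-- Solvable: the derived series reaches zero. -/
def IsSolvable (I : Submodule F L) : Prop :=
  ∃ n : ℕ, derivedSeries I n = ⊥

variable (F L) in
/-- Semi-simple: the Leibniz kernel contains every solvable (two-sided) ideal. -/
def IsSemisimple : Prop :=
  ∀ I : Submodule F L, IsIdeal I → IsSolvable I → I ≤ leibnizKernel F L

end

end LeibnizAlg

/-! The Leibniz kernel `K` always annihilates `L` from the left, and left centrality adds the right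
side, so `L` is a central extension of the Lie algebra `G = L ⧸ K`. Semi-simplicity gives `G`
trivial radical, so in characteristic zero its Killing form κ is nondegenerate. Composed with a
functional, the cocycle of the extension is a bilinear form `B`; writing `B x = κ (D x)` makes `D` a
derivation, hence inner, `D = ad u`, and invariance gives `B x y = κ u ⁅x, y⁆`. So `B` is
alternating and all squares in `L` vanish. -/

namespace LeibnizAlg

open LieAlgebra

section Cocycle

variable {F G : Type*} [Field F] [LieRing G] [LieAlgebra F G] [FiniteDimensional F G]

/-- Every Leibniz `2`-cocycle on a Killing Lie algebra with values in the trivial module is a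
coboundary, because all derivations are inner. -/
theorem exists_killingForm_lie_eq_of_cocycle [IsKilling F G] (B : G →ₗ[F] G →ₗ[F] F)
    (hB : ∀ x y z, B ⁅x, y⁆ z = B x ⁅y, z⁆ - B y ⁅x, z⁆) :
    ∃ u : G, ∀ x y, B x y = killingForm F G u ⁅x, y⁆ := by
  have hκ : (killingForm F G).Nondegenerate := IsKilling.killingForm_nondegenerate F G
  let D₀ : G →ₗ[F] G := (LinearMap.BilinForm.toDual _ hκ).symm.toLinearMap ∘ₗ B
  have hD₀ (x y : G) : killingForm F G (D₀ x) y = B x y :=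
    LinearMap.BilinForm.apply_toDual_symm_apply (hB := hκ) (f := B x) y
  let D : LieDerivation F G G :=
    { D₀ with
      leibniz' := fun x y ↦ by
        change D₀ ⁅x, y⁆ = ⁅x, D₀ y⁆ - ⁅y, D₀ x⁆
        rw [← sub_eq_zero]
        -- Tested against `z`, invariance of κ turns the Leibniz rule for `D` into the cocycle
        -- identity for `B`.
        refine hκ.1 _ fun z ↦ ?_
        rw [map_sub, map_sub, LinearMap.sub_apply, LinearMap.sub_apply, hD₀, hB,
          LieModule.traceForm_apply_lie_apply', LieModule.traceForm_apply_lie_apply', hD₀, hD₀]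
        ring }
  obtain ⟨u, hu⟩ := LieDerivation.IsKilling.exists_eq_ad D
  refine ⟨u, fun x y ↦ ?_⟩
  have hx : D₀ x = ⁅u, x⁆ := by
    change D x = _
    rw [← hu]
    simp
  rw [← hD₀, hx, LieModule.traceForm_apply_lie_apply]

end Cocycle

section CentralExtension

variable {F L G : Type*} [Field F] [NonUnitalNonAssocRing L] [Module F L] [IsScalarTower F L L]
  [SMulCommClass F L L] [LieRing G] [LieAlgebra F G] [FiniteDimensional F G]

/-- In a left Leibniz algebra that is a central extension of a Killing Lie algebra, all squares
vanish. -/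
theorem mul_self_eq_zero_of_central_extension [IsKilling F G] (hLeib : IsLeftLeibniz L)
    (π : L →ₗ[F] G) (hπ : Function.Surjective π) (hmul : ∀ x y, π (x * y) = ⁅π x, π y⁆)
    (hleft : ∀ k x, π k = 0 → k * x = 0) (hright : ∀ k x, π k = 0 → x * k = 0) (x : L) :
    x * x = 0 := by
  obtain ⟨s, hs⟩ := π.exists_rightInverse_of_surjective (LinearMap.range_eq_top.mpr hπ)
  replace hs (g : G) : π (s g) = g := LinearMap.congr_fun hs g
  -- The kernel of `π` annihilates on both sides, so a product depends only on the images of its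
  -- factors.
  have mul_congr {a a' b b' : L} (ha : π a = π a') (hb : π b = π b') : a * b = a' * b' := by
    have h₁ := hleft (a - a') b (by rw [map_sub, ha, sub_self])
    have h₂ := hright (b - b') a' (by rw [map_sub, hb, sub_self])
    rw [sub_mul, sub_eq_zero] at h₁
    rw [mul_sub, sub_eq_zero] at h₂
    rw [h₁, h₂]
  have hsx : x * x = s (π x) * s (π x) := mul_congr (hs _).symm (hs _).symm
  rw [hsx, ← Module.forall_dual_apply_eq_zero_iff F]
  intro φ
  -- The failure of the linear section `s` to be multiplicative, seen through `φ`.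
  let B : G →ₗ[F] G →ₗ[F] F := LinearMap.mk₂ F (fun a b ↦ φ (s a * s b - s ⁅a, b⁆))
    (fun a a' b ↦ by simp only [map_add, map_sub, add_mul, add_lie]; ring)
    (fun c a b ↦ by simp only [map_smul, map_sub, smul_mul_assoc, smul_lie, smul_sub])
    (fun a b b' ↦ by simp only [map_add, map_sub, mul_add, lie_add]; ring)
    (fun c a b ↦ by simp only [map_smul, map_sub, mul_smul_comm, lie_smul, smul_sub])
  obtain ⟨u, hu⟩ := exists_killingForm_lie_eq_of_cocycle B fun a b c ↦ by
    have lie_left : s ⁅a, b⁆ * s c = (s a * s b) * s c :=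
      mul_congr (by rw [hs, hmul, hs, hs]) rfl
    have lie_right (a b c : G) : s a * s ⁅b, c⁆ = s a * (s b * s c) :=
      mul_congr rfl (by rw [hs, hmul, hs, hs])
    change φ (_ - _) = φ (_ - _) - φ (_ - _)
    rw [lie_left, lie_right, lie_right, lie_lie, hLeib (s a) (s b) (s c)]
    simp only [map_add, map_sub]
    ring
  have := hu (π x) (π x)
  change φ (_ - _) = _ at this
  -- On the diagonal `⁅π x, π x⁆ = 0` kills both the correction term in `B` and the coboundary.
  simpa using this

end CentralExtension

section Quotient

variable {F L : Type*} [Field F] [NonUnitalNonAssocRing L] [Module F L]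

theorem mul_self_mem_leibnizKernel (x : L) : x * x ∈ leibnizKernel F L :=
  Submodule.subset_span ⟨x, rfl⟩

variable [IsScalarTower F L L]

/-- The Leibniz identity `y(yx) = (yy)x + y(yx)` forces `(yy)x = 0`. -/
theorem mul_eq_zero_of_mem_leibnizKernel (hLeib : IsLeftLeibniz L) {k : L}
    (hk : k ∈ leibnizKernel F L) (x : L) : k * x = 0 := by
  induction hk using Submodule.span_induction with
  | mem k hk =>
    obtain ⟨y, rfl⟩ := hk
    simpa using hLeib y y x
  | zero => exact zero_mul x
  | add a b _ _ ha hb => rw [add_mul, ha, hb, add_zero]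
  | smul c a _ ha => rw [smul_mul_assoc, ha, smul_zero]

variable [SMulCommClass F L L]

/-- Makes a bracket defined through chosen representatives independent of the choice. -/
theorem mkQ_out_mul_out (hLeib : IsLeftLeibniz L) (hlc : IsLeftCentral F L) (x y : L) :
    (leibnizKernel F L).mkQ (Quotient.out ((leibnizKernel F L).mkQ x) *
      Quotient.out ((leibnizKernel F L).mkQ y)) = (leibnizKernel F L).mkQ (x * y) := by
  have out_sub_mem (z : L) :
      Quotient.out ((leibnizKernel F L).mkQ z) - z ∈ leibnizKernel F L :=
    (Submodule.Quotient.eq _).mp (Quotient.out_eq ((leibnizKernel F L).mkQ z))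
  have h₁ := mul_eq_zero_of_mem_leibnizKernel hLeib (out_sub_mem x)
    (Quotient.out ((leibnizKernel F L).mkQ y))
  have h₂ := hlc (out_sub_mem y) x
  rw [sub_mul, sub_eq_zero] at h₁
  rw [mul_sub, sub_eq_zero] at h₂
  rw [h₁, h₂]

/-- The Lie bracket induced on the quotient of a left central left Leibniz algebra by its Leibniz
kernel. -/
noncomputable abbrev quotientLieRing (hLeib : IsLeftLeibniz L) (hlc : IsLeftCentral F L) :
    LieRing (L ⧸ leibnizKernel F L) where
  bracket x y := (leibnizKernel F L).mkQ (Quotient.out x * Quotient.out y)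
  add_lie x y z := by
    obtain ⟨x, rfl⟩ := Submodule.mkQ_surjective _ x
    obtain ⟨y, rfl⟩ := Submodule.mkQ_surjective _ y
    obtain ⟨z, rfl⟩ := Submodule.mkQ_surjective _ z
    simp only [← map_add, mkQ_out_mul_out hLeib hlc, add_mul]
  lie_add x y z := by
    obtain ⟨x, rfl⟩ := Submodule.mkQ_surjective _ x
    obtain ⟨y, rfl⟩ := Submodule.mkQ_surjective _ y
    obtain ⟨z, rfl⟩ := Submodule.mkQ_surjective _ z
    simp only [← map_add, mkQ_out_mul_out hLeib hlc, mul_add]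
  lie_self x := by
    obtain ⟨x, rfl⟩ := Submodule.mkQ_surjective _ x
    rw [mkQ_out_mul_out hLeib hlc]
    exact (Submodule.Quotient.mk_eq_zero _).mpr (mul_self_mem_leibnizKernel x)
  leibniz_lie x y z := by
    obtain ⟨x, rfl⟩ := Submodule.mkQ_surjective _ x
    obtain ⟨y, rfl⟩ := Submodule.mkQ_surjective _ y
    obtain ⟨z, rfl⟩ := Submodule.mkQ_surjective _ z
    simp only [mkQ_out_mul_out hLeib hlc, ← map_add]
    rw [hLeib x y z]

/-- The Lie algebra structure on the quotient by the Leibniz kernel. -/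
noncomputable abbrev quotientLieAlgebra (hLeib : IsLeftLeibniz L) (hlc : IsLeftCentral F L) :
    letI := quotientLieRing hLeib hlc
    LieAlgebra F (L ⧸ leibnizKernel F L) :=
  letI := quotientLieRing hLeib hlc
  { lie_smul := fun c x y ↦ by
      obtain ⟨x, rfl⟩ := Submodule.mkQ_surjective _ x
      obtain ⟨y, rfl⟩ := Submodule.mkQ_surjective _ y
      change (leibnizKernel F L).mkQ _ = c • (leibnizKernel F L).mkQ _
      rw [← map_smul, mkQ_out_mul_out hLeib hlc, mkQ_out_mul_out hLeib hlc, mul_smul_comm,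
        map_smul] }

end Quotient

section Radical

variable {F L G : Type*} [Field F] [NonUnitalNonAssocRing L] [Module F L]
  [LieRing G] [LieAlgebra F G]

theorem derivedSeries_comap_le (π : L →ₗ[F] G) (hmul : ∀ x y, π (x * y) = ⁅π x, π y⁆)
    (I : LieIdeal F G) (n : ℕ) :
    derivedSeries (I.toSubmodule.comap π) n ≤
      (derivedSeriesOfIdeal F G n I).toSubmodule.comap π := by
  induction n with
  | zero => exact le_rfl
  | succ n ih =>
    refine Submodule.span_le.mpr ?_
    rintro _ ⟨a, ha, b, hb, rfl⟩
    change π (a * b) ∈ derivedSeriesOfIdeal F G (n + 1) I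
    rw [hmul, derivedSeriesOfIdeal_succ]
    exact LieSubmodule.lie_mem_lie (ih ha) (ih hb)

/-- The quotient of a semisimple left Leibniz algebra by its Leibniz kernel has trivial radical. -/
theorem hasTrivialRadical_of_isSemisimple [IsScalarTower F L L]
    (hLeib : IsLeftLeibniz L) (hss : IsSemisimple F L)
    (π : L →ₗ[F] G) (hπ : Function.Surjective π) (hmul : ∀ x y, π (x * y) = ⁅π x, π y⁆)
    (hker : π.ker = leibnizKernel F L) : HasTrivialRadical F G := by
  refine hasTrivialRadical_of_no_solvable_ideals fun I hI ↦ ?_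
  have hideal : IsIdeal (I.toSubmodule.comap π) := fun x a ha ↦ by
    change π (x * a) ∈ I ∧ π (a * x) ∈ I
    rw [hmul, hmul]
    exact ⟨lie_mem_right F G I _ _ ha, lie_mem_left F G I _ _ ha⟩
  have hsolv : IsSolvable (I.toSubmodule.comap π) := by
    obtain ⟨k, hk⟩ := (LieAlgebra.isSolvable_iff F I).mp hI
    rw [LieIdeal.derivedSeries_eq_bot_iff] at hk
    have hle := derivedSeries_comap_le π hmul I k
    rw [hk, LieSubmodule.bot_toSubmodule, Submodule.comap_bot, hker] at hle
    -- The `k`-th term is only known to lie in the Leibniz kernel, whose products vanish; hence one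
    -- further step.
    refine ⟨k + 1, Submodule.span_eq_bot.mpr ?_⟩
    rintro _ ⟨a, ha, b, -, rfl⟩
    exact mul_eq_zero_of_mem_leibnizKernel hLeib (hle ha) b
  have hle := hss _ hideal hsolv
  rw [LieSubmodule.eq_bot_iff]
  intro g hg
  obtain ⟨x, rfl⟩ := hπ g
  have hx : x ∈ π.ker := hker ▸ hle hg
  exact hx

end Radical

theorem IsLeftLeibniz.isLie_of_mul_self_eq_zero {L : Type*} [NonUnitalNonAssocRing L]
    (hLeib : IsLeftLeibniz L) (h : ∀ x : L, x * x = 0) : IsLie L where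
  mul_self := h
  jacobi x y z := by
    have skew (a b : L) : a * b = -(b * a) := by
      have hab := h (a + b)
      rw [add_mul, mul_add, mul_add, h, h, zero_add, add_zero] at hab
      exact eq_neg_of_add_eq_zero_left hab
    rw [hLeib x y z, skew z (x * y), skew z x, mul_neg]
    abel

end LeibnizAlg

theorem corollary4p3 {F L : Type*} [Field F] [CharZero F]
    [NonUnitalNonAssocRing L] [Module F L] [IsScalarTower F L L] [SMulCommClass F L L]
    [FiniteDimensional F L]
    (hLeib : LeibnizAlg.IsLeftLeibniz L)
    (hss : LeibnizAlg.IsSemisimple F L)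
    (hlc : LeibnizAlg.IsLeftCentral F L) :
    LeibnizAlg.IsLie L := by
  refine hLeib.isLie_of_mul_self_eq_zero ?_
  let K := LeibnizAlg.leibnizKernel F L
  let _ := LeibnizAlg.quotientLieRing hLeib hlc
  let _ := LeibnizAlg.quotientLieAlgebra hLeib hlc
  have hmul (x y : L) : K.mkQ (x * y) = ⁅K.mkQ x, K.mkQ y⁆ :=
    (LeibnizAlg.mkQ_out_mul_out hLeib hlc x y).symm
  have : LieAlgebra.HasTrivialRadical F (L ⧸ K) :=
    LeibnizAlg.hasTrivialRadical_of_isSemisimple hLeib hss K.mkQ K.mkQ_surjective hmul K.ker_mkQ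
  have mem_of_mkQ_eq_zero {k : L} (hk : K.mkQ k = 0) : k ∈ K :=
    (Submodule.Quotient.mk_eq_zero K).mp hk
  -- Characteristic zero enters here: instance search derives `IsKilling` from the trivial radical.
  exact LeibnizAlg.mul_self_eq_zero_of_central_extension hLeib K.mkQ K.mkQ_surjective hmul
    (fun k x hk ↦ LeibnizAlg.mul_eq_zero_of_mem_leibnizKernel hLeib (mem_of_mkQ_eq_zero hk) x)
    (fun k x hk ↦ hlc (mem_of_mkQ_eq_zero hk) x)
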